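/- Let $\mathcal W\subseteq\mathbb R^n$ be open and convex with $\mathbb R^n_+=\{x\in\mathbb R^n: x_i\ge 0 \text{ for all } i\}\subseteq\mathcal W$, let $f,g$ be continuously differentiable vector fields on $\mathcal W$ with values in $\mathbb R^n$, let $\tau_{\max}\ge 0$, and for $1\le i,j\le n$ let $\tau^i_j:[0,\infty)\to[0,\tau_{\max}]$ be continuous. Consider the delay system $$\dot x_i(t)=f_i(x(t))+g_i\bigl(x_1(t-\tau^i_1(t)),\dots,x_n(t-\tau^i_n(t))\bigr),\quad t\ge 0,\qquad x(t)=\varphi(t),\quad t\in[-\tau_{\max},0],\qquad (1)$$ for $i=1,\dots,n$. For vectors, $x\le y$ (resp. $x<y$) means $x_i\le y_i$ (resp. $x_i<y_i$) for all $i$. Suppose that $f$ is cooperative on $\mathbb R^n_+$, that is, $\frac{\partial f_i}{\partial x_j}(a)\ge 0$ for all $i\ne j$ and all $a\in\mathbb R^n_+$; that $g$ is order-preserving on $\mathbb R^n_+$, that is, $x\le y$ implies $g(x)\le g(y)$ for all $x,y\in\mathbb R^n_+$; and that (1) is positive, that is, solutions with initial function $\varphi\in C([-\tau_{\max},0],\mathbb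 R^n_+)$ remain in $\mathbb R^n_+$ for all $t\ge 0$. Suppose that (1) has a globally asymptotically stable equilibrium $x^\star\in\mathbb R^n_+$: that is, $f(x^\star)+g(x^\star)=0$; for every $\varphi\in C([-\tau_{\max},0],\mathbb R^n_+)$ the solution $x(t,\varphi)$ exists for all $t\ge 0$ and $x(t,\varphi)\to x^\star$ as $t\to\infty$; and for every $\varepsilon>0$ there is $\delta>0$ such that every $\varphi\in C([-\tau_{\max},0],\mathbb R^n_+)$ with $\|\varphi(t)-x^\star\|<\delta$ for all $t\in[-\tau_{\max},0]$ satisfies $\|x(t,\varphi)-x^\star\|<\varepsilon$ for all $t\ge 0$. Then: (a) There does not exist a vector $w\ne x^\star$ such that $w\ge x^\star$ and $f(w)+g(w)\ge 0$. (b) There exists a vector $v>0$ such that $v>x^\star$ and $f(v)+g(v)<0$. -/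

import Mathlib

open Set Filter Topology

/-- The closed non-negative orthant of `ℝⁿ`; `≤` on vectors is the componentwise order. -/
def orthant (n : ℕ) : Set (Fin n → ℝ) := {x | 0 ≤ x}

/-- A real square matrix is Metzler if its off-diagonal entries are non-negative. -/
def IsMetzler {n : ℕ} (A : Matrix (Fin n) (Fin n) ℝ) : Prop :=
  ∀ i j, i ≠ j → 0 ≤ A i j

/-- The Jacobian matrix of `f` at `a`: the entry `(i, j)` is the partial derivative of `f i` with
respect to the `j`-th coordinate. -/
noncomputable def jacobian {n : ℕ} (f : (Fin n → ℝ) → (Fin n → ℝ)) (a : Fin n → ℝ) :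
    Matrix (Fin n) (Fin n) ℝ :=
  Matrix.of fun i j => fderiv ℝ f a (Pi.single j 1) i

/-- `f` is cooperative on `D`: at every point of `D` it is continuously differentiable (in a
neighbourhood of the point in `ℝⁿ`) and its Jacobian matrix is Metzler. -/
def IsCooperativeOn {n : ℕ} (f : (Fin n → ℝ) → (Fin n → ℝ)) (D : Set (Fin n → ℝ)) : Prop :=
  ∀ a ∈ D, ContDiffAt ℝ 1 f a ∧ IsMetzler (jacobian f a)

/-- The data of a system with bounded heterogeneous time-varying delays
`xᵢ'(t) = fᵢ(x(t)) + gᵢ(x₁(t - τᵢ₁(t)), …, xₙ(t - τᵢₙ(t)))`, `t ≥ 0`,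
with its standing assumptions. -/
structure DelaySystem (n : ℕ) where
  /-- the open convex state domain -/
  W : Set (Fin n → ℝ)
  isOpen_W : IsOpen W
  convex_W : Convex ℝ W
  f : (Fin n → ℝ) → (Fin n → ℝ)
  g : (Fin n → ℝ) → (Fin n → ℝ)
  contDiffOn_f : ContDiffOn ℝ 1 f W
  contDiffOn_g : ContDiffOn ℝ 1 g W
  /-- the bound on the delays -/
  τmax : ℝ
  τmax_nonneg : 0 ≤ τmax
  /-- `τ i j` is the delay of the `j`-th component in the `i`-th equation -/
  τ : Fin n → Fin n → ℝ → ℝ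
  continuousOn_τ : ∀ i j, ContinuousOn (τ i j) (Ici 0)
  τ_mem : ∀ i j, ∀ t, 0 ≤ t → τ i j t ∈ Icc 0 τmax

namespace DelaySystem

variable {n : ℕ} (S : DelaySystem n)

/-- The vector `(x₁(t - τᵢ₁(t)), …, xₙ(t - τᵢₙ(t)))` entering the `i`-th equation. -/
def delayed (x : ℝ → Fin n → ℝ) (i : Fin n) (t : ℝ) : Fin n → ℝ :=
  fun j => x (t - S.τ i j t) j

/-- `x` is a solution on `[-τmax, ∞)` with initial function `φ` on `[-τmax, 0]`. The derivative is
two-sided at `t > 0` and one-sided at `t = 0`; the vectors at which `f` and `g` are evaluated are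
required to lie in `W`. Values of `x` before `-τmax` and of `φ` outside `[-τmax, 0]` play no
role. -/
structure IsSolution (φ x : ℝ → Fin n → ℝ) : Prop where
  initial : ∀ t ∈ Icc (-S.τmax) 0, x t = φ t
  continuousOn : ContinuousOn x (Ici (-S.τmax))
  mem : ∀ t, 0 ≤ t → x t ∈ S.W
  delayed_mem : ∀ t, 0 ≤ t → ∀ i, S.delayed x i t ∈ S.W
  hasDeriv : ∀ t, 0 ≤ t → ∀ i,
    HasDerivWithinAt (fun s => x s i) (S.f (x t) i + S.g (S.delayed x i t) i) (Ici 0) t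

/-- `φ` is a continuous function from `[-τmax, 0]` to the non-negative orthant. -/
def IsNonnegInitial (φ : ℝ → Fin n → ℝ) : Prop :=
  ContinuousOn φ (Icc (-S.τmax) 0) ∧ ∀ t ∈ Icc (-S.τmax) 0, φ t ∈ orthant n

/-- The system is positive: trajectories with non-negative initial functions stay
non-negative. -/
def IsPositive : Prop :=
  ∀ φ x, S.IsNonnegInitial φ → S.IsSolution φ x → ∀ t, 0 ≤ t → x t ∈ orthant n

/-- `p` is an equilibrium. -/
def IsEquilibrium (p : Fin n → ℝ) : Prop :=
  p ∈ S.W ∧ S.f p + S.g p = 0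

/-- `p` is a globally asymptotically stable equilibrium in the non-negative orthant, with respect
to all non-negative initial functions: solutions exist for all time, `p` is stable in the sense of
Lyapunov, and every solution converges to `p`. -/
structure IsGAS (p : Fin n → ℝ) : Prop where
  mem_orthant : p ∈ orthant n
  isEquilibrium : S.IsEquilibrium p
  exists_solution : ∀ φ, S.IsNonnegInitial φ → ∃ x, S.IsSolution φ x
  stable : ∀ ε > 0, ∃ δ > 0, ∀ φ x, S.IsNonnegInitial φ → S.IsSolution φ x →
    (∀ t ∈ Icc (-S.τmax) 0, ‖φ t - p‖ < δ) → ∀ t, 0 ≤ t → ‖x t - p‖ < ε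
  attractive : ∀ φ x, S.IsNonnegInitial φ → S.IsSolution φ x → Tendsto x atTop (𝓝 p)

end DelaySystem

/-!
The vector field `F = f + g` is quasimonotone on the upper set of `p`.

If `p ≤ w` and `0 ≤ F w`, let `x` be the solution started at the constant `w`. As long as `x` lies
at most `δ` below `w`, replacing the states by their suprema with `w` changes the right-hand side
by at most `L * δ`, and quasimonotonicity bounds the modified right-hand side from below by `F w`
in every component in which `x` is at or below `w`. Such a component cannot fall as fast as the
barrier `w - ε * exp ((L + 1) * t)`, so that `w ≤ x`. As `x` converges to `p`, this forces `w = p`.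

By compactness, at every point of the outer faces of a box with lower corner `p` some component of
`F` is therefore below a fixed `-c < 0`. Let `v` be a maximal point of the box at which `-c ≤ F`.
It lies off the outer faces, so a coordinate `v i` with `-c < F v i` could be increased. Thus
`F v = -c`, and quasimonotonicity together with `F p = 0` gives `p i < v i` for all `i`.
-/

open scoped NNReal

section Quasimonotone

variable {ι : Type*}

/-- The Kamke condition: `F` is quasimonotone on `D` if, on `D`, raising the other coordinates of
the argument does not lower the `i`-th component of `F`. -/
def QuasimonotoneOn (F : (ι → ℝ) → (ι → ℝ)) (D : Set (ι → ℝ)) : Prop :=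
  ∀ ⦃a⦄, a ∈ D → ∀ ⦃b⦄, b ∈ D → a ≤ b → ∀ ⦃i⦄, a i = b i → F a i ≤ F b i

theorem QuasimonotoneOn.mono {F : (ι → ℝ) → (ι → ℝ)} {D D' : Set (ι → ℝ)}
    (hF : QuasimonotoneOn F D) (h : D' ⊆ D) : QuasimonotoneOn F D' :=
  fun _ ha _ hb hab _ hi => hF (h ha) (h hb) hab hi

theorem QuasimonotoneOn.add_monotoneOn {F G : (ι → ℝ) → (ι → ℝ)} {D : Set (ι → ℝ)}
    (hF : QuasimonotoneOn F D) (hG : MonotoneOn G D) : QuasimonotoneOn (F + G) D :=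
  fun _ ha _ hb hab i hi => add_le_add (hF ha hb hab hi) (hG ha hb hab i)

theorem IsMetzler.mulVec_nonneg {n : ℕ} {A : Matrix (Fin n) (Fin n) ℝ} (hA : IsMetzler A)
    {y : Fin n → ℝ} (hy : 0 ≤ y) {i : Fin n} (hi : y i = 0) : 0 ≤ A.mulVec y i := by
  change 0 ≤ ∑ j, A i j * y j
  refine Finset.sum_nonneg fun j _ => ?_
  obtain rfl | hij := eq_or_ne i j
  · simp [hi]
  · exact mul_nonneg (hA i j hij) (hy j)

theorem jacobian_mulVec {n : ℕ} (f : (Fin n → ℝ) → (Fin n → ℝ)) (a y : Fin n → ℝ) :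
    (jacobian f a).mulVec y = fderiv ℝ f a y :=
  LinearMap.toMatrix'_mulVec (fderiv ℝ f a : (Fin n → ℝ) →ₗ[ℝ] Fin n → ℝ) y

theorem IsCooperativeOn.quasimonotoneOn {n : ℕ} {f : (Fin n → ℝ) → (Fin n → ℝ)}
    {D : Set (Fin n → ℝ)} (hf : IsCooperativeOn f D) (hD : Convex ℝ D) :
    QuasimonotoneOn f D := by
  intro a ha b hb hab i hi
  have hderiv : ∀ x ∈ D, HasFDerivWithinAt (fun x => f x i)
      ((ContinuousLinearMap.proj i).comp (fderiv ℝ f x)) D x := fun x hx =>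
    (hasFDerivAt_pi'.1 ((hf x hx).1.differentiableAt one_ne_zero).hasFDerivAt i).hasFDerivWithinAt
  obtain ⟨z, hz, hmvt⟩ := domain_mvt hderiv hD ha hb
  have hnonneg : 0 ≤ (jacobian f z).mulVec (b - a) i :=
    (hf z (hD.segment_subset ha hb hz)).2.mulVec_nonneg (sub_nonneg.2 hab) (sub_eq_zero.2 hi.symm)
  rw [jacobian_mulVec] at hnonneg
  exact sub_nonneg.1 (hnonneg.trans_eq hmvt.symm)

end Quasimonotone

section NegativePoint

variable {ι : Type*}

theorem exists_forall_apply_lt_neg_of_isCompact [Finite ι] {X : Type*}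
    [TopologicalSpace X] {A : Set X} (hA : IsCompact A) {F : X → ι → ℝ} (hF : ContinuousOn F A)
    (hneg : ∀ x ∈ A, ¬ 0 ≤ F x) :
    ∃ c > 0, ∀ x ∈ A, ∃ i, F x i < -c := by
  cases nonempty_fintype ι
  have hpos : ∀ x ∈ A, 0 < ‖(F x)⁻‖ := fun x hx =>
    norm_pos_iff.2 (negPart_eq_zero.not.2 (hneg x hx))
  have hcont : ContinuousOn (fun x => ‖(F x)⁻‖) A := (continuousOn_pi.2 fun i =>
    (continuousOn_pi.1 hF i).neg.sup continuousOn_const).norm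
  obtain ⟨c, hc, hcA⟩ := hA.exists_forall_le' hcont hpos
  refine ⟨c / 2, half_pos hc, fun x hx => ?_⟩
  by_contra! h
  refine (hcA x hx).not_gt (((pi_norm_le_iff_of_nonneg (half_pos hc).le).2 fun i => ?_).trans_lt
    (half_lt_self hc))
  rw [Real.norm_of_nonneg (negPart_nonneg (F x) i)]
  exact sup_le (neg_le.1 (h i)) (half_pos hc).le

theorem exists_maximal_of_isCompact [Finite ι] {A : Set (ι → ℝ)} (hA : IsCompact A)
    (hne : A.Nonempty) :
    ∃ v, Maximal (· ∈ A) v := by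
  cases nonempty_fintype ι
  obtain ⟨v, hv, hmax⟩ := hA.exists_isMaxOn hne
    (f := fun x : ι → ℝ => ∑ i, x i) (by fun_prop)
  refine ⟨v, hv, fun y hy hvy => ?_⟩
  have hsum : ∑ i, v i = ∑ i, y i :=
    (Finset.sum_le_sum fun i _ => hvy i).antisymm (hmax hy)
  exact fun i => ((Finset.sum_eq_sum_iff_of_le fun i _ => hvy i).1 hsum i (Finset.mem_univ i)).ge

theorem QuasimonotoneOn.apply_eq_of_maximal {F : (ι → ℝ) → (ι → ℝ)} {p q b v : ι → ℝ}
    (hF : QuasimonotoneOn F (Icc p q)) (hcont : ContinuousOn F (Icc p q))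
    (hv : Maximal (· ∈ {x ∈ Icc p q | b ≤ F x}) v) {i : ι} (hi : v i < q i) : F v i = b i := by
  classical
  obtain ⟨⟨hvbox, hbv⟩, hmax⟩ := hv
  refine le_antisymm (not_lt.1 fun hlt => ?_) (hbv i)
  let y : ℝ → ι → ℝ := Function.update v i
  have hle : ∀ r, v i ≤ r → v ≤ y r := fun r hr => le_update_self_iff.2 hr
  have hbox : ∀ r ∈ Icc (v i) (q i), y r ∈ Icc p q := fun r hr =>
    ⟨hvbox.1.trans (hle r hr.1), update_le_iff.2 ⟨hr.2, fun j _ => hvbox.2 j⟩⟩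
  have hy : Tendsto y (𝓝[>] v i) (𝓝[Icc p q] v) := by
    refine tendsto_nhdsWithin_iff.2 ⟨?_, ?_⟩
    · have hycont : Continuous y := continuous_const.update i continuous_id
      simpa [y] using (hycont.tendsto (v i)).mono_left nhdsWithin_le_nhds
    · filter_upwards [Ioc_mem_nhdsGT hi] with r hr using hbox r (Ioc_subset_Icc_self hr)
  have hFy : Tendsto (fun r => F (y r) i) (𝓝[>] v i) (𝓝 (F v i)) :=
    (tendsto_pi_nhds.1 (hcont v hvbox) i).comp hy
  obtain ⟨r, hbr, hr⟩ :=
    ((hFy.eventually_const_lt hlt).and (Ioc_mem_nhdsGT hi)).exists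
  have hyr : y r ∈ Icc p q := hbox r (Ioc_subset_Icc_self hr)
  have hbF : b ≤ F (y r) := by
    intro j
    obtain rfl | hj := eq_or_ne j i
    · exact hbr.le
    · exact (hbv j).trans
        (hF hvbox hyr (hle r hr.1.le) (Function.update_of_ne hj r v).symm)
  have hri : y r i ≤ v i := hmax ⟨hyr, hbF⟩ (hle r hr.1.le) i
  exact hri.not_gt (by simpa [y] using hr.1)

theorem QuasimonotoneOn.exists_forall_apply_neg [Finite ι] {F : (ι → ℝ) → (ι → ℝ)}
    {p q : ι → ℝ} (hF : QuasimonotoneOn F (Icc p q)) (hcont : ContinuousOn F (Icc p q))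
    (hpq : ∀ i, p i < q i) (hFp : F p = 0) (hunique : ∀ w ∈ Icc p q, 0 ≤ F w → w = p) :
    ∃ v ∈ Icc p q, (∀ i, p i < v i) ∧ ∀ i, F v i < 0 := by
  let faces : Set (ι → ℝ) := Icc p q ∩ ⋃ i, {x | x i = q i}
  have hfaces : IsCompact faces := isCompact_Icc.inter_right <|
    isClosed_iUnion_of_finite fun i => isClosed_eq (continuous_apply i) continuous_const
  have hneg : ∀ x ∈ faces, ¬ 0 ≤ F x := by
    rintro x ⟨hx, hxq⟩ hFx
    obtain ⟨i, hi⟩ := mem_iUnion.1 hxq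
    exact (hpq i).ne (hunique x hx hFx ▸ hi)
  obtain ⟨c, hc, hgap⟩ :=
    exists_forall_apply_lt_neg_of_isCompact hfaces (hcont.mono inter_subset_left) hneg
  let A : Set (ι → ℝ) := {x ∈ Icc p q | (fun _ => -c) ≤ F x}
  have hA : IsCompact A := isCompact_Icc.of_isClosed_subset
    (hcont.preimage_isClosed_of_isClosed isClosed_Icc isClosed_Ici) inter_subset_left
  have hp : p ∈ Icc p q := left_mem_Icc.2 fun i => (hpq i).le
  have hpA : p ∈ A := ⟨hp, fun i => by simp [hFp, hc.le]⟩
  obtain ⟨v, hmax⟩ := exists_maximal_of_isCompact hA ⟨p, hpA⟩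
  obtain ⟨hv, hvF⟩ := hmax.prop
  have hvq : ∀ i, v i < q i := fun i => (hv.2 i).lt_of_ne fun hi =>
    let ⟨j, hj⟩ := hgap v ⟨hv, mem_iUnion.2 ⟨i, hi⟩⟩
    hj.not_ge (hvF j)
  have hFv : ∀ i, F v i < 0 := fun i =>
    (hF.apply_eq_of_maximal hcont hmax (hvq i)).trans_lt (neg_neg_of_pos hc)
  refine ⟨v, hv, fun i => (hv.1 i).lt_of_ne fun hi => (hFv i).not_ge ?_, hFv⟩
  simpa [hFp] using hF hp hv hv.1 hi

end NegativePoint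

section Comparison

variable {ι : Type*} {t₀ T : ℝ}

theorem forall_apply_pos_of_deriv_pos_of_apply_eq_zero [Finite ι] {z z' : ℝ → ι → ℝ}
    (hderiv : ∀ t ∈ Icc t₀ T, HasDerivWithinAt z (z' t) (Icc t₀ T) t) (hinit : ∀ i, 0 < z t₀ i)
    (hzero : ∀ t ∈ Icc t₀ T, ∀ i, (∀ s ∈ Icc t₀ t, 0 ≤ z s) → z t i = 0 → 0 < z' t i) :
    ∀ t ∈ Icc t₀ T, ∀ i, 0 < z t i := by
  cases nonempty_fintype ι
  by_contra! ⟨t', ht', i', hi'⟩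
  have hcont : ContinuousOn z (Icc t₀ T) := fun t ht => (hderiv t ht).continuousWithinAt
  have hexit : IsCompact (⋃ i, Icc t₀ T ∩ (fun t => z t i) ⁻¹' Iic 0) :=
    isCompact_iUnion fun i => isCompact_Icc.of_isClosed_subset
      ((continuousOn_pi.1 hcont i).preimage_isClosed_of_isClosed isClosed_Icc isClosed_Iic)
      inter_subset_left
  obtain ⟨t, ht, hleast⟩ := hexit.exists_isLeast ⟨t', mem_iUnion.2 ⟨i', ht', hi'⟩⟩
  obtain ⟨i, htT, hzt⟩ := mem_iUnion.1 ht
  have ht₀ : t₀ < t := htT.1.lt_of_ne fun h => (hinit i).not_ge (h ▸ hzt)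
  have hsub : Icc t₀ t ⊆ Icc t₀ T := Icc_subset_Icc_right htT.2
  have hbefore : ∀ s ∈ Ico t₀ t, 0 ≤ z s := fun s hs j => by
    by_contra! h
    exact hs.2.not_ge (hleast (mem_iUnion.2 ⟨j, hsub (Ico_subset_Icc_self hs), h.le⟩))
  have hupto : ∀ s ∈ Icc t₀ t, 0 ≤ z s := by
    rw [← closure_Ico ht₀.ne] at hsub ⊢
    exact fun s hs => le_on_closure hbefore continuousOn_const (hcont.mono hsub) hs
  have hzt0 : z t i = 0 := le_antisymm hzt (hupto t (right_mem_Icc.2 ht₀.le) i)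
  have hmin : IsMinOn (fun s => z s i) (Icc t₀ t) t := fun s hs => by
    simpa [hzt0] using hupto s hs i
  have hderiv_i : HasDerivWithinAt (fun s => z s i) (z' t i) (Icc t₀ t) t :=
    hasDerivWithinAt_pi.1 ((hderiv t htT).mono hsub) i
  have hslope : 0 ≤ (t₀ - t) * z' t i := by
    simpa using hmin.localize.hasFDerivWithinAt_nonneg hderiv_i.hasFDerivWithinAt
      (sub_mem_posTangentConeAt_of_segment_subset
        (segment_symm ℝ t t₀ ▸ segment_eq_Icc ht₀.le).subset)
  exact hslope.not_gt (mul_neg_of_neg_of_pos (sub_neg.2 ht₀) (hzero t htT i hupto hzt0))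

theorem nonneg_of_neg_mul_le_deriv [Finite ι] {u u' : ℝ → ι → ℝ} {a : ℝ} {L : ℝ≥0}
    (ha : a ≤ t₀)
    (hinit : ∀ s ∈ Icc a t₀, 0 ≤ u s)
    (hderiv : ∀ t ∈ Icc t₀ T, HasDerivWithinAt u (u' t) (Icc t₀ T) t)
    (hbound : ∀ t ∈ Icc t₀ T, ∀ i, ∀ δ : ℝ, 0 ≤ δ → u t i ≤ 0 →
      (∀ s ∈ Icc a t, ∀ j, -δ ≤ u s j) → -(L * δ) ≤ u' t i) :
    ∀ t ∈ Icc t₀ T, 0 ≤ u t := by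
  cases nonempty_fintype ι
  let β : ℝ → ℝ := fun t => Real.exp ((L + 1) * t)
  have hβpos : ∀ t, 0 < β t := fun t => Real.exp_pos _
  have hβmono : Monotone β := fun s t hst => by dsimp only [β]; gcongr
  have hβderiv : ∀ t, HasDerivAt β ((L + 1) * β t) t := fun t => by
    simpa [β, mul_comm] using ((hasDerivAt_id t).const_mul ((L : ℝ) + 1)).exp
  have hbarrier : ∀ ε > 0, ∀ t ∈ Icc t₀ T, ∀ i, 0 < u t i + ε * β t := by
    intro ε hε
    refine forall_apply_pos_of_deriv_pos_of_apply_eq_zero (z := fun t i => u t i + ε * β t)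
      (z' := fun t i => u' t i + ε * ((L + 1) * β t)) (fun t ht => ?_) (fun i => ?_) ?_
    · exact hasDerivWithinAt_pi.2 fun i => (hasDerivWithinAt_pi.1 (hderiv t ht) i).add
        ((hβderiv t).const_mul ε).hasDerivWithinAt
    · exact add_pos_of_nonneg_of_pos (hinit t₀ (right_mem_Icc.2 ha) i) (mul_pos hε (hβpos t₀))
    · intro t ht i hupto hti
      have hδ : 0 < ε * β t := mul_pos hε (hβpos t)
      have hhistory : ∀ s ∈ Icc a t, ∀ j, -(ε * β t) ≤ u s j := by
        intro s hs j
        rcases le_total s t₀ with hs₀ | hs₀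
        · exact (neg_nonpos.2 hδ.le).trans (hinit s ⟨hs.1, hs₀⟩ j)
        · have hj : 0 ≤ u s j + ε * β s := hupto s ⟨hs₀, hs.2⟩ j
          have hβs : ε * β s ≤ ε * β t := mul_le_mul_of_nonneg_left (hβmono hs.2) hε.le
          linarith
      have hrate := hbound t ht i _ hδ.le (by linarith) hhistory
      linarith
  intro t ht i
  refine le_of_forall_pos_lt_add fun η hη => ?_
  simpa [(hβpos t).ne'] using hbarrier (η / β t) (div_pos hη (hβpos t)) t ht i

theorem exists_apply_sup_sub_mul_le {κ : Type*} [Fintype ι] [Fintype κ] {h : (ι → ℝ) → κ → ℝ}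
    {A W : Set (ι → ℝ)} {w : ι → ℝ} (hh : LocallyLipschitzOn W h) (hA : IsCompact A)
    (hAW : A ⊆ W) (hwW : Ici w ⊆ W) :
    ∃ K : ℝ≥0, ∀ y ∈ A, ∀ δ : ℝ, 0 ≤ δ → (∀ j, w j - δ ≤ y j) →
      ∀ i, h (y ⊔ w) i - K * δ ≤ h y i := by
  have hsup : IsCompact ((· ⊔ w) '' A) := hA.image <|
    continuous_pi fun j => (continuous_apply j).sup continuous_const
  have hsupW : (· ⊔ w) '' A ⊆ W := image_subset_iff.2 fun _ _ => hwW (mem_Ici.2 le_sup_right)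
  obtain ⟨K, hK⟩ :=
    (hh.mono (union_subset hAW hsupW)).exists_lipschitzOnWith_of_compact (hA.union hsup)
  refine ⟨K, fun y hy δ hδ hwy i => ?_⟩
  have hdist : dist (y ⊔ w) y ≤ δ := by
    refine (dist_pi_le_iff hδ).2 fun j => ?_
    rw [Real.dist_eq, Pi.sup_apply, abs_of_nonneg (sub_nonneg.2 le_sup_left), sub_le_iff_le_add]
    exact sup_le (le_add_of_nonneg_left hδ) (sub_le_iff_le_add'.1 (hwy j))
  have hcomp : h (y ⊔ w) i - h y i ≤ K * δ := calc
    h (y ⊔ w) i - h y i ≤ dist (h (y ⊔ w) i) (h y i) := le_abs_self _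
    _ ≤ dist (h (y ⊔ w)) (h y) := dist_le_pi_dist _ _ i
    _ ≤ K * dist (y ⊔ w) y := hK.dist_le_mul _ (.inr (mem_image_of_mem _ hy)) _ (.inl hy)
    _ ≤ K * δ := by gcongr
  linarith

end Comparison

namespace DelaySystem

variable {n : ℕ} {S : DelaySystem n} {φ x : ℝ → Fin n → ℝ} {w p : Fin n → ℝ}

theorem sub_delay_mem_Icc {i j : Fin n} {t : ℝ} (ht : 0 ≤ t) :
    t - S.τ i j t ∈ Icc (-S.τmax) t := by
  have := S.τ_mem i j t ht
  exact ⟨by linarith [this.2], sub_le_self t this.1⟩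

theorem IsSolution.continuousOn_delayed (hx : S.IsSolution φ x) (i : Fin n) :
    ContinuousOn (S.delayed x i) (Ici 0) :=
  continuousOn_pi.2 fun j => (continuousOn_pi.1 hx.continuousOn j).comp
    (continuousOn_id.sub (S.continuousOn_τ i j)) fun _ ht => (sub_delay_mem_Icc ht).1

theorem IsSolution.exists_neg_mul_le_rate (hx : S.IsSolution φ x) (hW : Ici w ⊆ S.W)
    (hf : QuasimonotoneOn S.f (Ici w)) (hg : MonotoneOn S.g (Ici w)) (hFw : 0 ≤ S.f w + S.g w)
    (T : ℝ) :
    ∃ L : ℝ≥0, ∀ t ∈ Icc 0 T, ∀ i, ∀ δ : ℝ, 0 ≤ δ → x t i ≤ w i →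
      (∀ s ∈ Icc (-S.τmax) t, ∀ j, w j - δ ≤ x s j) →
      -(L * δ) ≤ S.f (x t) i + S.g (S.delayed x i t) i := by
  have hstates : IsCompact (x '' Icc 0 T) := isCompact_Icc.image_of_continuousOn
    (hx.continuousOn.mono fun t ht => (neg_nonpos.2 S.τmax_nonneg).trans ht.1)
  have hdelayed : IsCompact (⋃ i, S.delayed x i '' Icc 0 T) := isCompact_iUnion fun i =>
    isCompact_Icc.image_of_continuousOn ((hx.continuousOn_delayed i).mono Icc_subset_Ici_self)
  obtain ⟨K, hK⟩ := exists_apply_sup_sub_mul_le (S.contDiffOn_f.locallyLipschitzOn S.convex_W)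
    hstates (image_subset_iff.2 fun t ht => hx.mem t ht.1) hW
  obtain ⟨K', hK'⟩ := exists_apply_sup_sub_mul_le (S.contDiffOn_g.locallyLipschitzOn S.convex_W)
    hdelayed (iUnion_subset fun i => image_subset_iff.2 fun t ht => hx.delayed_mem t ht.1 i) hW
  refine ⟨K + K', fun t ht i δ hδ hxw hhistory => ?_⟩
  have hfw : S.f w i ≤ S.f (x t ⊔ w) i :=
    hf self_mem_Ici (mem_Ici.2 le_sup_right) le_sup_right (sup_eq_right.2 hxw).symm
  have hgw : S.g w i ≤ S.g (S.delayed x i t ⊔ w) i :=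
    hg self_mem_Ici (mem_Ici.2 le_sup_right) le_sup_right i
  have hfx : S.f (x t ⊔ w) i - K * δ ≤ S.f (x t) i :=
    hK _ (mem_image_of_mem x ht) δ hδ
      (hhistory t ⟨(neg_nonpos.2 S.τmax_nonneg).trans ht.1, le_rfl⟩) i
  have hgx : S.g (S.delayed x i t ⊔ w) i - K' * δ ≤ S.g (S.delayed x i t) i :=
    hK' _ (mem_iUnion.2 ⟨i, mem_image_of_mem _ ht⟩) δ hδ
      (fun j => hhistory _ (sub_delay_mem_Icc ht.1) j) i
  have hFi : 0 ≤ S.f w i + S.g w i := hFw i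
  push_cast
  linarith

theorem IsSolution.le_of_subequilibrium (hx : S.IsSolution φ x) (hW : Ici w ⊆ S.W)
    (hf : QuasimonotoneOn S.f (Ici w)) (hg : MonotoneOn S.g (Ici w)) (hFw : 0 ≤ S.f w + S.g w)
    (hφ : ∀ t ∈ Icc (-S.τmax) 0, w ≤ φ t) {T : ℝ} (hT : 0 ≤ T) : w ≤ x T := by
  obtain ⟨L, hL⟩ := hx.exists_neg_mul_le_rate hW hf hg hFw T
  have hderiv : ∀ t ∈ Icc 0 T, HasDerivWithinAt (fun s => x s - w)
      (fun i => S.f (x t) i + S.g (S.delayed x i t) i) (Icc 0 T) t := fun t ht =>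
    (hasDerivWithinAt_pi.2 fun i => (hx.hasDeriv t ht.1 i).mono Icc_subset_Ici_self).sub_const w
  refine sub_nonneg.1 (nonneg_of_neg_mul_le_deriv (L := L) (neg_nonpos.2 S.τmax_nonneg)
    (fun s hs => ?_) hderiv (fun t ht i δ hδ hxw hhistory => ?_) T (right_mem_Icc.2 hT))
  · simpa [hx.initial s hs] using hφ s hs
  · exact hL t ht i δ hδ (sub_nonpos.1 hxw) fun s hs j =>
      sub_le_iff_le_add.2 (neg_le_sub_iff_le_add.1 (hhistory s hs j))

theorem IsSolution.subequilibrium_le_of_tendsto (hx : S.IsSolution φ x)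
    (hlim : Tendsto x atTop (𝓝 p)) (hW : Ici w ⊆ S.W) (hf : QuasimonotoneOn S.f (Ici w))
    (hg : MonotoneOn S.g (Ici w)) (hFw : 0 ≤ S.f w + S.g w)
    (hφ : ∀ t ∈ Icc (-S.τmax) 0, w ≤ φ t) : w ≤ p :=
  ge_of_tendsto hlim <| (eventually_ge_atTop 0).mono fun _ ht =>
    hx.le_of_subequilibrium hW hf hg hFw hφ ht

theorem IsGAS.exists_solution_tendsto (hp : S.IsGAS p) (hw : w ∈ orthant n) :
    ∃ x, S.IsSolution (fun _ => w) x ∧ Tendsto x atTop (𝓝 p) :=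
  have hinit : S.IsNonnegInitial fun _ => w := ⟨continuousOn_const, fun _ _ => hw⟩
  (hp.exists_solution _ hinit).imp fun x hx => ⟨hx, hp.attractive _ x hinit hx⟩

end DelaySystem

theorem lemma1_general {n : ℕ} (S : DelaySystem n) {p : Fin n → ℝ} (hW : Ici p ⊆ S.W)
    (hf : QuasimonotoneOn S.f (Ici p)) (hg : MonotoneOn S.g (Ici p)) (hFp : S.f p + S.g p = 0)
    (hconv : ∀ w, p ≤ w → ∃ x, S.IsSolution (fun _ => w) x ∧ Tendsto x atTop (𝓝 p)) :
    (¬ ∃ w : Fin n → ℝ, w ≠ p ∧ p ≤ w ∧ 0 ≤ S.f w + S.g w) ∧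
    (∃ v : Fin n → ℝ, (∀ i, p i < v i) ∧ ∀ i, S.f v i + S.g v i < 0) := by
  have hunique : ∀ w, p ≤ w → 0 ≤ S.f w + S.g w → w = p := by
    intro w hpw hFw
    obtain ⟨x, hx, hlim⟩ := hconv w hpw
    have hsub : Ici w ⊆ Ici p := Ici_subset_Ici.2 hpw
    exact (hx.subequilibrium_le_of_tendsto hlim (hsub.trans hW) (hf.mono hsub) (hg.mono hsub) hFw
      fun _ _ => le_rfl).antisymm hpw
  have hcont : ContinuousOn (S.f + S.g) (Icc p (p + 1)) :=
    (S.contDiffOn_f.continuousOn.add S.contDiffOn_g.continuousOn).mono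
      (Icc_subset_Ici_self.trans hW)
  obtain ⟨v, -, hpv, hv⟩ :=
    ((hf.add_monotoneOn hg).mono Icc_subset_Ici_self).exists_forall_apply_neg hcont
      (fun i => lt_add_one (p i)) hFp fun w hw => hunique w hw.1
  exact ⟨fun ⟨w, hne, hpw, hFw⟩ => hne (hunique w hpw hFw), v, hpv, hv⟩

theorem lemma1 {n : ℕ} (S : DelaySystem n) (hW : orthant n ⊆ S.W)
    (hf : IsCooperativeOn S.f (orthant n)) (hg : MonotoneOn S.g (orthant n))
    (hpos : S.IsPositive) (p : Fin n → ℝ) (hp : S.IsGAS p) :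
    (¬ ∃ w : Fin n → ℝ, w ≠ p ∧ p ≤ w ∧ 0 ≤ S.f w + S.g w) ∧
    (∃ v : Fin n → ℝ, (∀ i, 0 < v i) ∧ (∀ i, p i < v i) ∧ ∀ i, S.f v i + S.g v i < 0) := by
  have hsub : Ici p ⊆ orthant n := Ici_subset_Ici.2 hp.mem_orthant
  obtain ⟨hno, v, hpv, hv⟩ := lemma1_general S (hsub.trans hW)
    ((hf.quasimonotoneOn (convex_Ici 0)).mono hsub) (hg.mono hsub) hp.isEquilibrium.2
    fun w hw => hp.exists_solution_tendsto (hsub hw)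
  exact ⟨hno, v, fun i => (hp.mem_orthant i).trans_lt (hpv i), hpv, hv⟩
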